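/- Let $a,b,k$ be nonnegative integers with $0\le k\le b$. Let $\nu=E^aNE^bN$, and let $P(\nu)$ be the set of lattice paths with north steps $N$ and east steps $E$ that start at the origin, have the same endpoints as $\nu$ and stay weakly above $\nu$. Put $\delta(k)=(\delta_1,\delta_2)=(k,0)$. Along a path $\mu\in P(\nu)$, give the origin the altitude $0$; each $E$ step lowers the altitude by $1$ and the $i$th $N$ step raises it by $\delta_i$. For a lattice point $x$ of $\mu$ that is preceded by an $E$ step and followed by an $N$ step, let $y$ be the first lattice point of $\mu$ after $x$ with the same altitude as $x$; the rotation of $\mu$ at $x$ interchanges the subpath of $\mu$ from $x$ to $y$ with the $E$ step immediately preceding $x$. The alt $2$-row-Tamari lattice $\mathsf T_{\delta(k)}(a,b)$ is the set $P(\nu)$ ordered by $\mu\le\mu'$ if and only if $\mu'$ is obtained from $\mu$ by a finite (possibly empty) sequence of rotations. For $x\in \mathsf T_{\delta(k)}(a,b)$, let $\mathsf{ddeg}(x)$ be the number of elements covered by $x$, let $\mathsf{Pop}^{\downarrow}(x)$ be the meet of $x$ and all the elements covered by $x$, and let $\mathrm{Row}(x)$ (rowmotion) be the unique maximal element of $\{y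 : x\wedge y=\mathsf{Pop}^{\downarrow}(x)\}$. Then $\mathrm{Row}$ is a well-defined bijection of $\mathsf T_{\delta(k)}(a,b)$. **Theorem 4.9.** Write $b=s(a+1)+r$ with integers $s\ge 0$ and $0\le r\le a$. The orbit structure of rowmotion on $\mathsf T_{\delta(k)}(a,b)$ and the sums of $\mathsf{ddeg}$ over the orbits (that is, the multiset of pairs $(|\mathcal O|,\sum_{z\in\mathcal O}\mathsf{ddeg}(z))$, with one pair for each orbit $\mathcal O$) do not depend on $k\in\{0,\dots,b\}$. The orbits are exactly the following. 1. There are $\left\lceil\frac{a-r}{2}\right\rceil$ orbits $\mathcal O_1$ of size $a+2b+2-r$, each with $\sum_{z\in\mathcal O_1}\mathsf{ddeg}(z)=2|\mathcal O_1|-4-2s$. 2. There are $\left\lceil\frac{r-1}{2}\right\rceil$ orbits $\mathcal O_2$ of size $2a+2b+3-r$, each with $\sum_{z\in\mathcal O_2}\mathsf{ddeg}(z)=2|\mathcal O_2|-6-2s$. 3. If $a$ and $r$ are even, there is one extra orbit $\mathcal O_3$; if $a$ is even and $r$ is odd, there is one extra orbit $\mathcal O_4$; if $a$ and $r$ are odd,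 there are two extra orbits $\mathcal O_3$ and $\mathcal O_4$; if $a$ is odd and $r$ is even, there is no extra orbit. Here $|\mathcal O_3|=\frac{a-r}{2}+b+1$ and $\sum_{z\in\mathcal O_3}\mathsf{ddeg}(z)=2|\mathcal O_3|-2-s$, while $|\mathcal O_4|=\frac{3-r}{2}+a+b$ and $\sum_{z\in\mathcal O_4}\mathsf{ddeg}(z)=2|\mathcal O_4|-3-s$. Moreover, $\mathsf{ddeg}$ is homometric under rowmotion: any two orbits of the same size have the same sum of $\mathsf{ddeg}$. -/

import Mathlib

namespace AltTamari

/-- The two kinds of unit steps of a lattice path: north and east. -/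
inductive Step
  | N
  | E
  deriving DecidableEq

/-- A lattice path starting at the origin, written as its word of steps. -/
abbrev Path := List Step

/-- `μ` is a `ν`-path: it has the same endpoints as `ν` and stays weakly above `ν`
(after every number `i` of steps, `μ` has made at least as many north steps as `ν`). -/
def IsNuPath (ν μ : Path) : Prop :=
  μ.count Step.N = ν.count Step.N ∧ μ.count Step.E = ν.count Step.E ∧
    ∀ i : ℕ, (ν.take i).count Step.N ≤ (μ.take i).count Step.N

/-- The `δ`-altitude of the endpoint of the initial segment `w` of a path:
it starts at `0`, an east step lowers it by `1`, the `i`-th north step (`i ≥ 1`) raises it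
by `δ i`; see the three lemmas below. -/
def altitude (δ : ℕ → ℕ) (w : Path) : ℤ :=
  (∑ i ∈ Finset.range (w.count Step.N), (δ (i + 1) : ℤ)) - (w.count Step.E : ℤ)

lemma altitude_nil (δ : ℕ → ℕ) : altitude δ [] = 0 := by
  simp [altitude]

lemma altitude_append_E (δ : ℕ → ℕ) (w : Path) :
    altitude δ (w ++ [Step.E]) = altitude δ w - 1 := by
  simp [altitude, List.count_append]
  ring

lemma altitude_append_N (δ : ℕ → ℕ) (w : Path) :
    altitude δ (w ++ [Step.N]) = altitude δ w + δ (w.count Step.N + 1) := by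
  simp [altitude, List.count_append, Finset.sum_range_succ]
  ring

/-- `μ'` is obtained from `μ` by a `δ`-rotation at a valley point `x`. Here
`μ = p E q t`, the point `x` is the endpoint of `p E`, it is followed by a north step, the
endpoint `y` of `p E q` is the first lattice point after `x` with the same `δ`-altitude as `x`,
and the subpath `q` from `x` to `y` is interchanged with the east step preceding `x`. -/
def Rotation (δ : ℕ → ℕ) (μ μ' : Path) : Prop :=
  ∃ p q t : Path,
    μ = p ++ [Step.E] ++ q ++ t ∧
    μ' = p ++ q ++ [Step.E] ++ t ∧
    q.head? = some Step.N ∧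
    altitude δ (p ++ [Step.E] ++ q) = altitude δ (p ++ [Step.E]) ∧
    ∀ j : ℕ, 0 < j → j < q.length →
      altitude δ (p ++ [Step.E] ++ q.take j) ≠ altitude δ (p ++ [Step.E])

/-- The sum of the heights of the east steps of a path that starts at height `h`. -/
def eastHeight : ℕ → Path → ℕ
  | _, [] => 0
  | h, Step.N :: w => eastHeight (h + 1) w
  | h, Step.E :: w => h + eastHeight h w

lemma eastHeight_append (h : ℕ) (u v : Path) :
    eastHeight h (u ++ v) = eastHeight h u + eastHeight (h + u.count Step.N) v := by
  induction u generalizing h with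
  | nil => simp [eastHeight]
  | cons c u ih =>
    cases c
    · simp [eastHeight, ih, add_assoc, add_comm 1]
    · simp [eastHeight, ih, add_assoc]

lemma Rotation.eastHeight_lt {δ : ℕ → ℕ} {μ μ' : Path} (h : Rotation δ μ μ') :
    eastHeight 0 μ < eastHeight 0 μ' := by
  obtain ⟨p, q, t, rfl, rfl, hq, -, -⟩ := h
  cases q with
  | nil => simp at hq
  | cons c q =>
    obtain rfl : c = Step.N := by simpa using hq
    simp [eastHeight_append, eastHeight]
    omega

/-- The underlying set of the alt `ν`-Tamari lattice with increment vector `δ`: the `ν`-paths. -/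
@[ext]
structure Tam (ν : Path) (δ : ℕ → ℕ) where
  /-- the path -/
  path : Path
  isNuPath : IsNuPath ν path

/-- The alt `ν`-Tamari order on the `ν`-paths: `x ≤ y` if `y` is reached from `x` by a finite
sequence of `δ`-rotations. -/
instance (ν : Path) (δ : ℕ → ℕ) : PartialOrder (Tam ν δ) where
  le := Relation.ReflTransGen fun x y => Rotation δ x.path y.path
  le_refl _ := Relation.ReflTransGen.refl
  le_trans _ _ _ := Relation.ReflTransGen.trans
  le_antisymm x y hxy hyx := by
    have mono : ∀ u v : Tam ν δ,
        Relation.ReflTransGen (fun x y : Tam ν δ => Rotation δ x.path y.path) u v →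
        u = v ∨ eastHeight 0 u.path < eastHeight 0 v.path := by
      intro u v h
      induction h with
      | refl => exact Or.inl rfl
      | tail _ hr ih =>
        have := hr.eastHeight_lt
        rcases ih with rfl | ih
        · exact Or.inr this
        · exact Or.inr (ih.trans this)
    rcases mono x y hxy with h | h
    · exact h
    · rcases mono y x hyx with h' | h'
      · exact h'.symm
      · exact absurd h (lt_asymm h')

instance (ν : Path) (δ : ℕ → ℕ) : Finite (Tam ν δ) := by
  refine Finite.of_injective
    (fun x : Tam ν δ => (⟨x.path, ?_⟩ : {l // l ∈ ν.permutations.toFinset})) ?_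
  · rw [List.mem_toFinset, List.mem_permutations, List.perm_iff_count]
    rintro (_ | _)
    · exact x.isNuPath.1
    · exact x.isNuPath.2.1
  · intro x y h
    exact Tam.ext (by simpa using h)

noncomputable instance (ν : Path) (δ : ℕ → ℕ) : Fintype (Tam ν δ) := Fintype.ofFinite _

/-- The path `E^a N E^b N`. -/
def twoRowPath (a b : ℕ) : Path :=
  List.replicate a Step.E ++ [Step.N] ++ List.replicate b Step.E ++ [Step.N]

/-- The increment vector `δ(k) = (k, 0)`, with entries indexed from `1`. -/
def twoRowIncrement (k : ℕ) : ℕ → ℕ := fun i => if i = 1 then k else 0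

/-- The alt 2-row-Tamari lattice for `ν = E^a N E^b N` and the increment vector `(k, 0)`,
to be used for `0 ≤ k ≤ b`. -/
abbrev TwoRow (a b k : ℕ) : Type := Tam (twoRowPath a b) (twoRowIncrement k)

section Rowmotion

variable {L : Type*} [PartialOrder L]

/-- `p` is the image of `x` under the pop-stack sorting operator:
the meet of `x` and all the elements covered by `x`. -/
def IsPopDown (x p : L) : Prop := IsGLB (insert x {z : L | z ⋖ x}) p

/-- `y` is the image of `x` under rowmotion: the only maximal element of
`{w | Pop x = x ∧ w}`. -/
def IsRow (x y : L) : Prop :=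
  ∃ p : L, IsPopDown x p ∧ ∀ w : L, Maximal (fun w : L => IsGLB {x, w} p) w ↔ w = y

/-- The permutation `σ` of `L` is rowmotion. -/
def IsRowmotion (σ : Equiv.Perm L) : Prop := ∀ x : L, IsRow x (σ x)

/-- The down-degree: the number of elements covered by `x`. -/
noncomputable def ddeg (x : L) : ℕ := {z : L | z ⋖ x}.ncard

variable [Fintype L]

open Classical in
/-- The set of the orbits of a permutation of a finite set. -/
noncomputable def orbits (σ : Equiv.Perm L) : Finset (Finset L) :=
  Finset.univ.image fun x => Finset.univ.filter fun y => σ.SameCycle x y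

/-- The multiset of the pairs (size of `O`, sum of the down-degrees over `O`), with one entry for
each orbit `O`. -/
noncomputable def orbitData (σ : Equiv.Perm L) : Multiset (ℚ × ℚ) :=
  (orbits σ).val.map fun O => ((O.card : ℚ), ∑ z ∈ O, (ddeg z : ℚ))

/-- A statistic is homometric if it has the same sum over any two orbits of the same size. -/
def IsHomometric (σ : Equiv.Perm L) (st : L → ℕ) : Prop :=
  ∀ O ∈ orbits σ, ∀ O' ∈ orbits σ, O.card = O'.card → ∑ z ∈ O, st z = ∑ z ∈ O', st z

end Rowmotion

/-- The list of (orbit size, down-degree sum), with multiplicities, for `b = s (a + 1) + r`. -/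
noncomputable def expectedOrbitData (a b s r : ℕ) : Multiset (ℚ × ℚ) :=
  let n₁ : ℚ := a + 2 * b + 2 - r
  let n₂ : ℚ := 2 * a + 2 * b + 3 - r
  let n₃ : ℚ := (a - r) / 2 + b + 1
  let n₄ : ℚ := (3 - r) / 2 + a + b
  let O₁ : ℚ × ℚ := (n₁, 2 * n₁ - 4 - 2 * s)
  let O₂ : ℚ × ℚ := (n₂, 2 * n₂ - 6 - 2 * s)
  let O₃ : ℚ × ℚ := (n₃, 2 * n₃ - 2 - s)
  let O₄ : ℚ × ℚ := (n₄, 2 * n₄ - 3 - s)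
  Multiset.replicate ⌈((a : ℚ) - r) / 2⌉.toNat O₁
    + Multiset.replicate ⌈((r : ℚ) - 1) / 2⌉.toNat O₂
    + (if Even a ∧ Even r then {O₃} else 0)
    + (if Even a ∧ Odd r then {O₄} else 0)
    + (if Odd a ∧ Odd r then {O₃, O₄} else 0)

end AltTamari

/-! A path above `ν` has the form E^(a-u) N E^j N E^(b+u-j), so it is a pair (u, j) with u ≤ a and j
≤ b + u. In these coordinates the rotation order is given by three linear inequalities
(`TwoRow.nonempty_coordinates`), which makes meets, covers, pop and rowmotion explicit (`RowStep`).
Left of column k, rowmotion raises j by one. From column k on, it raises j - u by one until j = b +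
u, and then j falls to 0. The row drops by one cyclically modulo a + 1, except that column k is
always sent to row a.

Every orbit therefore meets column k. From (w, k) the first return takes b + w + 1 steps and ends in
the row congruent to a - r - w modulo a + 1 (`pow_apply_section`). The return map on rows is an
involution that does not involve k. Its fixed points and 2-cycles are the orbits
(`orbitData_eq_map`), and counting them by parity gives the list.

The down-degree is 2, less one at the end of a row (j = b + u) and less one in row 0 or column k.
Between two visits to column k the first loss occurs once. The second occurs once per jump to row a,
that is, s + 1 or s + 2 times. -/

namespace AltTamari

/-! ### Rowmotion in integer coordinates. -/

/-- Integer coordinates on a partial order in which the order relation is that of the alt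
2-row-Tamari lattice: the path `E^(a-u) N E^j N E^(b+u-j)` has row `u` and column `j`. -/
structure Coordinates (L : Type*) [PartialOrder L] (a b k : ℕ) where
  /-- the row -/
  row : L → ℕ
  /-- the column -/
  col : L → ℕ
  row_le : ∀ x, row x ≤ a
  col_le : ∀ x, col x ≤ b + row x
  inj : ∀ x y, row x = row y → col x = col y → x = y
  surj : ∀ u j, u ≤ a → j ≤ b + u → ∃ x, row x = u ∧ col x = j
  le_iff : ∀ x y, x ≤ y ↔
    row x ≤ row y ∧ min (col y) k ≤ col x ∧ col y + row x ≤ col x + row y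

namespace Coordinates

variable {L : Type*} [PartialOrder L] {a b k : ℕ} (c : Coordinates L a b k)

lemma lt_iff (x y : L) : x < y ↔ (c.row x ≤ c.row y ∧ min (c.col y) k ≤ c.col x ∧
    c.col y + c.row x ≤ c.col x + c.row y) ∧ ¬ (c.row x = c.row y ∧ c.col x = c.col y) := by
  rw [lt_iff_le_and_ne, c.le_iff]
  refine and_congr_right fun _ => not_congr ⟨?_, fun h => c.inj _ _ h.1 h.2⟩
  rintro rfl
  simp

/-- Lower bounds have row at most the minimum, and bounds from below on the column and on column
minus row. The greatest one takes the largest row and then the smallest column allowed. `k ≤ b`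
keeps this column inside the row. -/
lemma isGLB_pair_iff (hk : k ≤ b) (x y p : L) : IsGLB {x, y} p ↔
    c.row p = min (c.row x) (c.row y) ∧
    c.col p = max (max (min (c.col x) k) (min (c.col y) k))
      (max (c.col x + min (c.row x) (c.row y) - c.row x)
        (c.col y + min (c.row x) (c.row y) - c.row y)) := by
  have hx := c.col_le x
  have hy := c.col_le y
  have hx' := c.row_le x
  have hy' := c.row_le y
  obtain ⟨m, hm1, hm2⟩ := c.surj (min (c.row x) (c.row y))
    (max (max (min (c.col x) k) (min (c.col y) k))
      (max (c.col x + min (c.row x) (c.row y) - c.row x)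
        (c.col y + min (c.row x) (c.row y) - c.row y))) (by omega) (by omega)
  have hm : IsGLB {x, y} m := by
    refine ⟨?_, fun z hz => ?_⟩
    · rintro z (rfl | rfl) <;> rw [c.le_iff] <;> omega
    · have h1 := (c.le_iff _ _).1 (hz (Set.mem_insert _ _))
      have h2 := (c.le_iff _ _).1 (hz (Set.mem_insert_of_mem _ rfl))
      rw [c.le_iff]
      omega
  constructor
  · intro h
    rw [h.unique hm]
    exact ⟨hm1, hm2⟩
  · rintro ⟨h1, h2⟩
    rwa [c.inj p m (h1.trans hm1.symm) (h2.trans hm2.symm)]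

lemma covBy_iff (hk : k ≤ b) (z x : L) : z ⋖ x ↔
    (c.row z = c.row x ∧ c.col z = c.col x + 1) ∨
    (c.row z + 1 = c.row x ∧
      (c.col x < k ∧ c.col z = c.col x ∨ k < c.col x ∧ c.col z + 1 = c.col x)) := by
  have hx := c.col_le x
  have hz := c.col_le z
  have hx' := c.row_le x
  have hz' := c.row_le z
  constructor
  · rintro ⟨hlt, hcov⟩
    rw [c.lt_iff] at hlt
    -- No (u, j) lies strictly between z and x. It suffices to test the claimed lower covers of x as
    -- (u, j): below x there is always one of them weakly above z, so z must be equal to it.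
    have key : ∀ u j, u ≤ a → j ≤ b + u → ¬ (((c.row z ≤ u ∧ min j k ≤ c.col z ∧
        j + c.row z ≤ c.col z + u) ∧ ¬ (c.row z = u ∧ c.col z = j)) ∧
        ((u ≤ c.row x ∧ min (c.col x) k ≤ j ∧ c.col x + u ≤ j + c.row x) ∧
          ¬ (u = c.row x ∧ j = c.col x))) := by
      intro u j hu hj
      obtain ⟨y, rfl, rfl⟩ := c.surj u j hu hj
      rw [← c.lt_iff, ← c.lt_iff]
      exact fun h => hcov h.1 h.2
    rcases Nat.lt_or_ge (c.col x) (b + c.row x) with h | h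
    · have k1 := key (c.row x) (c.col x + 1) hx' (by omega)
      rcases Nat.eq_zero_or_pos (c.row x) with h0 | h0
      · omega
      rcases lt_trichotomy (c.col x) k with h3 | h3 | h3
      · have k2 := key (c.row x - 1) (c.col x) (by omega) (by omega)
        omega
      · omega
      · have k2 := key (c.row x - 1) (c.col x - 1) (by omega) (by omega)
        omega
    · rcases Nat.eq_zero_or_pos (c.row x) with h0 | h0
      · omega
      have k2 := key (c.row x - 1) (c.col x - 1) (by omega) (by omega)
      omega
  · intro h
    refine ⟨(c.lt_iff _ _).2 (by omega), fun y h1 h2 => ?_⟩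
    rw [c.lt_iff] at h1 h2
    have := c.col_le y
    omega

/-- The cases record which of the two possible covers exist: the one in the same row is missing at
the end of the row, the one in the row below is missing in row 0 and in column k. -/
lemma isPopDown_of_coordinates (hk : k ≤ b) (x p : L)
    (hp : (0 < c.row x ∧ c.col x < k ∧ c.row p + 1 = c.row x ∧ c.col p = c.col x + 1) ∨
      (0 < c.row x ∧ k < c.col x ∧ c.col x < b + c.row x ∧
        c.row p + 1 = c.row x ∧ c.col p = c.col x) ∨
      (0 < c.row x ∧ c.col x = b + c.row x ∧ c.row p + 1 = c.row x ∧
        c.col p + 1 = c.col x) ∨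
      (c.row x = 0 ∧ c.col x < b ∧ c.row p = 0 ∧ c.col p = c.col x + 1) ∨
      (c.row x = 0 ∧ c.col x = b ∧ c.row p = 0 ∧ c.col p = b) ∨
      (0 < c.row x ∧ c.col x = k ∧ c.row p = c.row x ∧ c.col p = k + 1)) :
    IsPopDown x p := by
  have hx := c.col_le x
  have hx' := c.row_le x
  constructor
  · rintro z (rfl | hz)
    · rw [c.le_iff]
      omega
    · rw [Set.mem_ofPred_eq, c.covBy_iff hk] at hz
      rw [c.le_iff]
      have := c.col_le z
      omega
  · intro q hq
    have h0 := (c.le_iff _ _).1 (hq (Set.mem_insert _ _))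
    have key : ∀ u j, u ≤ a → j ≤ b + u → ((u = c.row x ∧ j = c.col x + 1) ∨
        (u + 1 = c.row x ∧ (c.col x < k ∧ j = c.col x ∨ k < c.col x ∧ j + 1 = c.col x))) →
        c.row q ≤ u ∧ min j k ≤ c.col q ∧ j + c.row q ≤ c.col q + u := by
      intro u j hu hj
      obtain ⟨z, rfl, rfl⟩ := c.surj u j hu hj
      rw [← c.covBy_iff hk, ← c.le_iff]
      exact fun h => hq (Set.mem_insert_of_mem _ h)
    have k1 := key (c.row x) (c.col x + 1) hx'
    have k2 := key (c.row x - 1) (c.col x) (by omega)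
    have k3 := key (c.row x - 1) (c.col x - 1) (by omega)
    rw [c.le_iff]
    have := c.col_le q
    rcases hp with h | h | h | h | h | h
    · have k1 := k1 (by omega) (by omega)
      have k2 := k2 (by omega) (by omega)
      omega
    · have k1 := k1 (by omega) (by omega)
      have k3 := k3 (by omega) (by omega)
      omega
    · have k3 := k3 (by omega) (by omega)
      omega
    · have k1 := k1 (by omega) (by omega)
      omega
    · omega
    · have k1 := k1 (by omega) (by omega)
      omega

/-- The coordinates `(u', j')` are those of the image under rowmotion of `(u, j)`. -/
def RowStep (a b k u j u' j' : ℕ) : Prop :=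
  (j < k ∧ (u = 0 ∧ u' = a ∨ u' + 1 = u) ∧ j' = j + 1) ∨
  (k ≤ j ∧ j = b + u ∧ (u = 0 ∧ u' = a ∨ u' + 1 = u) ∧ j' = 0) ∨
  (j = k ∧ j < b + u ∧ u' = a ∧ j' + u = k + a + 1) ∨
  (k < j ∧ j < b + u ∧ u = 0 ∧ u' = a ∧ j' = j + a + 1) ∨
  (k < j ∧ j < b + u ∧ u' + 1 = u ∧ j' = j)

-- Here (u, j) is the pop of x. The point y is not just maximal but the greatest element of {w | x ∧
-- w = pop x}, and this yields uniqueness at once.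
set_option maxHeartbeats 1000000 in
lemma isRow_of_pop (hk : k ≤ b) {x y : L} (u j : ℕ)
    (hp : (0 < c.row x ∧ c.col x < k ∧ u + 1 = c.row x ∧ j = c.col x + 1) ∨
      (0 < c.row x ∧ k < c.col x ∧ c.col x < b + c.row x ∧ u + 1 = c.row x ∧ j = c.col x) ∨
      (0 < c.row x ∧ c.col x = b + c.row x ∧ u + 1 = c.row x ∧ j + 1 = c.col x) ∨
      (c.row x = 0 ∧ c.col x < b ∧ u = 0 ∧ j = c.col x + 1) ∨
      (c.row x = 0 ∧ c.col x = b ∧ u = 0 ∧ j = b) ∨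
      (0 < c.row x ∧ c.col x = k ∧ u = c.row x ∧ j = k + 1))
    (h : RowStep a b k (c.row x) (c.col x) (c.row y) (c.col y)) : IsRow x y := by
  have hx := c.col_le x
  have hx' := c.row_le x
  have hy := c.col_le y
  obtain ⟨p, rfl, rfl⟩ := c.surj u j (by omega) (by omega)
  refine ⟨p, c.isPopDown_of_coordinates hk x p hp, ?_⟩
  have h1 : IsGLB {x, y} p := by
    rw [c.isGLB_pair_iff hk]
    rcases h with h | h | h | h | h <;> rcases hp with hp | hp | hp | hp | hp | hp <;> omega
  have h2 : ∀ w, IsGLB {x, w} p → w ≤ y := by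
    intro w hw
    rw [c.isGLB_pair_iff hk] at hw
    have := c.col_le w
    have := c.row_le w
    rw [c.le_iff]
    -- Knowing which row is smaller removes the minimum and one truncated subtraction from the meet
    -- formula.
    rcases le_total (c.row x) (c.row w) with hl | hl
    · rw [min_eq_left hl, Nat.add_sub_cancel] at hw
      obtain ⟨hw1, hw2⟩ := hw
      rcases h with h | h | h | h | h <;> rcases hp with hp | hp | hp | hp | hp | hp <;> omega
    · rw [min_eq_right hl, Nat.add_sub_cancel] at hw
      obtain ⟨hw1, hw2⟩ := hw
      rcases h with h | h | h | h | h <;> rcases hp with hp | hp | hp | hp | hp | hp <;> omega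
  intro w
  constructor
  · intro hw
    exact le_antisymm (h2 w hw.1) (hw.2 h1 (h2 w hw.1))
  · rintro rfl
    exact ⟨h1, fun z hz _ => h2 z hz⟩

lemma isRow_of_rowStep (hk : k ≤ b) {x y : L}
    (h : RowStep a b k (c.row x) (c.col x) (c.row y) (c.col y)) : IsRow x y := by
  have hx := c.col_le x
  rcases Nat.eq_zero_or_pos (c.row x) with h0 | h0
  · rcases Nat.lt_or_ge (c.col x) b with h1 | h1
    · exact c.isRow_of_pop hk 0 (c.col x + 1) (by omega) h
    · exact c.isRow_of_pop hk 0 b (by omega) h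
  · rcases lt_trichotomy (c.col x) k with h1 | h1 | h1
    · exact c.isRow_of_pop hk (c.row x - 1) (c.col x + 1) (by omega) h
    · exact c.isRow_of_pop hk (c.row x) (k + 1) (by omega) h
    · rcases Nat.lt_or_ge (c.col x) (b + c.row x) with h2 | h2
      · exact c.isRow_of_pop hk (c.row x - 1) (c.col x) (by omega) h
      · exact c.isRow_of_pop hk (c.row x - 1) (c.col x - 1) (by omega) h

lemma exists_rowStep (hk : k ≤ b) (x : L) : ∃ y, RowStep a b k (c.row x) (c.col x) (c.row y) (c.col y) := by
  have hx := c.col_le x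
  have hx' := c.row_le x
  have key : ∀ u j, u ≤ a → j ≤ b + u → RowStep a b k (c.row x) (c.col x) u j →
      ∃ y, RowStep a b k (c.row x) (c.col x) (c.row y) (c.col y) := by
    intro u j hu hj h
    obtain ⟨y, rfl, rfl⟩ := c.surj u j hu hj
    exact ⟨y, h⟩
  unfold RowStep at *
  rcases lt_trichotomy (c.col x) k with h1 | h1 | h1
  · rcases Nat.eq_zero_or_pos (c.row x) with h0 | h0
    · exact key a (c.col x + 1) (by omega) (by omega) (by omega)
    · exact key (c.row x - 1) (c.col x + 1) (by omega) (by omega) (by omega)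
  · rcases Nat.lt_or_ge (c.col x) (b + c.row x) with h2 | h2
    · exact key a (k + a + 1 - c.row x) le_rfl (by omega) (by omega)
    · exact key a 0 (by omega) (by omega) (by omega)
  · rcases Nat.eq_zero_or_pos (c.row x) with h0 | h0
    · rcases Nat.lt_or_ge (c.col x) b with h2 | h2
      · exact key a (c.col x + a + 1) le_rfl (by omega) (by omega)
      · exact key a 0 le_rfl (by omega) (by omega)
    · rcases Nat.lt_or_ge (c.col x) (b + c.row x) with h2 | h2
      · exact key (c.row x - 1) (c.col x) (by omega) (by omega) (by omega)
      · exact key (c.row x - 1) 0 (by omega) (by omega) (by omega)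

lemma exists_rowmotion [Fintype L] (hk : k ≤ b) : ∃ σ : Equiv.Perm L, IsRowmotion σ ∧
    ∀ x, RowStep a b k (c.row x) (c.col x) (c.row (σ x)) (c.col (σ x)) := by
  choose f hf using c.exists_rowStep hk
  have hinj : Function.Injective f := by
    intro x y hxy
    have h1 := hf x
    have h2 := hf y
    rw [← hxy] at h2
    have hx := c.col_le x
    have hx' := c.row_le x
    have hy := c.col_le y
    have hy' := c.row_le y
    have := c.col_le (f x)
    unfold RowStep at h1 h2
    rcases h1 with h1 | h1 | h1 | h1 | h1 <;> rcases h2 with h2 | h2 | h2 | h2 | h2 <;>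
      apply c.inj <;> omega
  exact ⟨Equiv.ofBijective f (Finite.injective_iff_bijective.1 hinj),
    fun x => c.isRow_of_rowStep hk (hf x), hf⟩

/-- There is at most one cover in the same row and at most one in the row below; each indicator
marks the absence of one of them. -/
lemma ddeg_eq [Finite L] (hk : k ≤ b) (x : L) : (ddeg x : ℤ) =
    2 - (if c.col x = b + c.row x then 1 else 0)
      - (if c.row x = 0 ∨ c.col x = k then 1 else 0) := by
  have hx := c.col_le x
  have hx' := c.row_le x
  have hA : {z : L | c.row z = c.row x ∧ c.col z = c.col x + 1}.ncard =
      if c.col x = b + c.row x then 0 else 1 := by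
    split_ifs with h
    · convert Set.ncard_empty L
      ext z
      have := c.col_le z
      simp only [Set.mem_ofPred_eq, Set.mem_empty_iff_false, iff_false]
      omega
    · obtain ⟨y, hy1, hy2⟩ := c.surj (c.row x) (c.col x + 1) hx' (by omega)
      rw [Set.ncard_eq_one]
      refine ⟨y, Set.ext fun z => ⟨fun hz => c.inj _ _ (hz.1.trans hy1.symm)
        (hz.2.trans hy2.symm), ?_⟩⟩
      rintro rfl
      exact ⟨hy1, hy2⟩
  have hB : {z : L | c.row z + 1 = c.row x ∧ (c.col x < k ∧ c.col z = c.col x ∨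
      k < c.col x ∧ c.col z + 1 = c.col x)}.ncard =
      if c.row x = 0 ∨ c.col x = k then 0 else 1 := by
    split_ifs with h
    · convert Set.ncard_empty L
      ext z
      simp only [Set.mem_ofPred_eq, Set.mem_empty_iff_false, iff_false]
      omega
    · obtain ⟨y, hy1, hy2⟩ := c.surj (c.row x - 1) (if c.col x < k then c.col x else c.col x - 1)
        (by omega) (by split_ifs <;> omega)
      rw [Set.ncard_eq_one]
      refine ⟨y, Set.ext fun z => ⟨fun hz => c.inj _ _ ?_ ?_, ?_⟩⟩
      · have := hz.1
        omega
      · rw [Set.mem_ofPred_eq] at hz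
        split_ifs at hy2 <;> omega
      · rintro rfl
        rw [Set.mem_ofPred_eq]
        split_ifs at hy2 <;> omega
  have hU : {z : L | z ⋖ x} = {z : L | c.row z = c.row x ∧ c.col z = c.col x + 1} ∪
      {z : L | c.row z + 1 = c.row x ∧ (c.col x < k ∧ c.col z = c.col x ∨
      k < c.col x ∧ c.col z + 1 = c.col x)} := by
    ext z
    exact c.covBy_iff hk z x
  have hdisj : Disjoint {z : L | c.row z = c.row x ∧ c.col z = c.col x + 1}
      {z : L | c.row z + 1 = c.row x ∧ (c.col x < k ∧ c.col z = c.col x ∨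
      k < c.col x ∧ c.col z + 1 = c.col x)} := by
    rw [Set.disjoint_left]
    rintro z ⟨h1, -⟩ ⟨h2, -⟩
    omega
  rw [ddeg, hU, Set.ncard_union_eq hdisj (Set.toFinite _) (Set.toFinite _), hA, hB]
  split_ifs <;> norm_num

end Coordinates

end AltTamari

/-! ### Orbits from a first-return map; uniqueness of rowmotion. -/

namespace AltTamari

section ReturnMap

variable {L : Type*} [PartialOrder L] [Fintype L]

open Classical in
/-- If `S w`, `w < m`, are points that meet every orbit of `σ`, and `σ` returns from `S w` to these
points for the first time after `n w` steps, in `S (ρ w)` with `ρ` an involution, then the orbits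
correspond to the orbits of `ρ`. -/
lemma orbitData_eq_map (σ : Equiv.Perm L) (m : ℕ) (S : ℕ → L) (n ρ : ℕ → ℕ)
    (hn : ∀ w < m, 0 < n w) (hρ : ∀ w < m, ρ w < m) (hρρ : ∀ w < m, ρ (ρ w) = w)
    (hret : ∀ w < m, (σ ^ n w) (S w) = S (ρ w))
    (hfirst : ∀ w < m, ∀ w' < m, ∀ i < n w, (σ ^ i) (S w) = S w' → i = 0 ∧ w = w')
    (hits : ∀ x, ∃ w < m, σ.SameCycle (S w) x) :
    orbitData σ = ((Finset.range m).filter fun w => w ≤ ρ w).val.map fun w =>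
      if w = ρ w then ((n w : ℚ), ∑ i ∈ Finset.range (n w), (ddeg ((σ ^ i) (S w)) : ℚ))
      else ((n w : ℚ) + n (ρ w), ∑ i ∈ Finset.range (n w), (ddeg ((σ ^ i) (S w)) : ℚ) +
        ∑ i ∈ Finset.range (n (ρ w)), (ddeg ((σ ^ i) (S (ρ w))) : ℚ)) := by
  let B : ℕ → Finset L := fun w => (Finset.range (n w)).image fun i => (σ ^ i) (S w)
  have hB : ∀ w x, x ∈ B w ↔ ∃ i < n w, (σ ^ i) (S w) = x := by simp [B]
  -- Cancelling the smaller power turns a coincidence of two excursions into an early visit to a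
  -- section point, which `hfirst` excludes.
  have key : ∀ w < m, ∀ w' < m, ∀ i < n w, ∀ i' < n w', i ≤ i' →
      (σ ^ i) (S w) = (σ ^ i') (S w') → i = i' ∧ w = w' := by
    intro w hw w' hw' i hi i' hi' hle h
    obtain ⟨d, rfl⟩ := Nat.exists_eq_add_of_le hle
    rw [pow_add, Equiv.Perm.mul_apply, (σ ^ i).injective.eq_iff] at h
    have := hfirst w' hw' w hw d (by omega) h.symm
    omega
  have key' : ∀ w < m, ∀ w' < m, ∀ i < n w, ∀ i' < n w',
      (σ ^ i) (S w) = (σ ^ i') (S w') → i = i' ∧ w = w' := by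
    intro w hw w' hw' i hi i' hi' h
    rcases le_total i i' with hle | hle
    · exact key w hw w' hw' i hi i' hi' hle h
    · have := key w' hw' w hw i' hi' i hi hle h.symm
      exact ⟨this.1.symm, this.2.symm⟩
  have hinj : ∀ w < m, Set.InjOn (fun i => (σ ^ i) (S w)) (Finset.range (n w)) := by
    intro w hw i hi i' hi' h
    exact (key' w hw w hw i (by simpa using hi) i' (by simpa using hi') h).1
  have hdisj : ∀ w < m, ∀ w' < m, w ≠ w' → Disjoint (B w) (B w') := by
    intro w hw w' hw' hne
    rw [Finset.disjoint_left]
    intro x hx hx'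
    obtain ⟨i, hi, rfl⟩ := (hB _ _).1 hx
    obtain ⟨i', hi', h⟩ := (hB _ _).1 hx'
    exact hne (key' w hw w' hw' i hi i' hi' h.symm).2
  have hcard : ∀ w < m, (B w).card = n w := by
    intro w hw
    rw [Finset.card_image_of_injOn (hinj w hw), Finset.card_range]
  have hsum : ∀ w < m, ∑ z ∈ B w, (ddeg z : ℚ) =
      ∑ i ∈ Finset.range (n w), (ddeg ((σ ^ i) (S w)) : ℚ) := by
    intro w hw
    exact Finset.sum_image (hinj w hw)
  have hself : ∀ w < m, S w ∈ B w := fun w hw => (hB _ _).2 ⟨0, hn w hw, rfl⟩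
  have hstep : ∀ w < m, ∀ x ∈ B w, σ x ∈ B w ∪ B (ρ w) := by
    intro w hw x hx
    obtain ⟨i, hi, rfl⟩ := (hB _ _).1 hx
    rw [← Equiv.Perm.mul_apply, ← pow_succ']
    rcases Nat.lt_or_ge (i + 1) (n w) with h | h
    · exact Finset.mem_union_left _ ((hB _ _).2 ⟨i + 1, h, rfl⟩)
    · obtain h : i + 1 = n w := by omega
      rw [h, hret w hw]
      exact Finset.mem_union_right _ (hself _ (hρ w hw))
  have hclosed : ∀ w < m, ∀ x ∈ B w ∪ B (ρ w), σ x ∈ B w ∪ B (ρ w) := by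
    intro w hw x hx
    rcases Finset.mem_union.1 hx with hx | hx
    · exact hstep w hw x hx
    · have := hstep _ (hρ w hw) x hx
      rwa [hρρ w hw, Finset.union_comm] at this
  have hpow : ∀ w < m, ∀ i : ℕ, (σ ^ i) (S w) ∈ B w ∪ B (ρ w) := by
    intro w hw i
    induction i with
    | zero => exact Finset.mem_union_left _ (hself w hw)
    | succ i ih =>
      rw [pow_succ', Equiv.Perm.mul_apply]
      exact hclosed w hw _ ih
  have horb : ∀ w < m, (Finset.univ.filter fun y => σ.SameCycle (S w) y) = B w ∪ B (ρ w) := by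
    intro w hw
    ext y
    simp only [Finset.mem_filter, Finset.mem_univ, true_and]
    constructor
    · intro h
      obtain ⟨i, -, rfl⟩ := h.exists_pow_eq'
      exact hpow w hw i
    · intro h
      rcases Finset.mem_union.1 h with h | h
      · obtain ⟨i, -, rfl⟩ := (hB _ _).1 h
        exact ⟨i, by simp⟩
      · obtain ⟨i, -, rfl⟩ := (hB _ _).1 h
        refine ⟨((i + n w : ℕ) : ℤ), ?_⟩
        rw [zpow_natCast, pow_add, Equiv.Perm.mul_apply, hret w hw]
  -- The condition `w ≤ ρ w` selects one representative from each cycle of the involution.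
  have horbits : orbits σ = ((Finset.range m).filter fun w => w ≤ ρ w).image
      fun w => B w ∪ B (ρ w) := by
    ext O
    simp only [orbits, Finset.mem_image, Finset.mem_univ, true_and, Finset.mem_filter,
      Finset.mem_range]
    constructor
    · rintro ⟨x, rfl⟩
      obtain ⟨w, hw, h⟩ := hits x
      have hO : (Finset.univ.filter fun y => σ.SameCycle x y) = B w ∪ B (ρ w) := by
        rw [← horb w hw]
        ext y
        simp only [Finset.mem_filter, Finset.mem_univ, true_and]
        exact ⟨h.trans, h.symm.trans⟩
      rw [hO]
      rcases le_total w (ρ w) with hle | hle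
      · exact ⟨w, ⟨hw, hle⟩, rfl⟩
      · exact ⟨ρ w, ⟨hρ w hw, by rwa [hρρ w hw]⟩, by rw [hρρ w hw, Finset.union_comm]⟩
    · rintro ⟨w, ⟨hw, -⟩, rfl⟩
      exact ⟨S w, horb w hw⟩
  have hinjO : Set.InjOn (fun w => B w ∪ B (ρ w))
      ((Finset.range m).filter fun w => w ≤ ρ w : Finset ℕ) := by
    intro w hw w' hw' h
    simp only [Finset.coe_filter, Finset.mem_range, Set.mem_ofPred_eq] at hw hw'
    have h1 : S w' ∈ B w ∪ B (ρ w) := by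
      have h : B w ∪ B (ρ w) = B w' ∪ B (ρ w') := h
      rw [h]
      exact Finset.mem_union_left _ (hself w' hw'.1)
    rcases Finset.mem_union.1 h1 with h1 | h1
    · obtain ⟨i, hi, h2⟩ := (hB _ _).1 h1
      exact (hfirst w hw.1 w' hw'.1 i hi h2).2
    · obtain ⟨i, hi, h2⟩ := (hB _ _).1 h1
      have h3 := (hfirst _ (hρ w hw.1) w' hw'.1 i hi h2).2
      have h4 := hw'.2
      rw [← h3, hρρ w hw.1] at h4
      omega
  rw [orbitData, horbits, Finset.image_val_of_injOn hinjO, Multiset.map_map]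
  refine Multiset.map_congr rfl fun w hw => ?_
  have hw : w < m := by
    rw [Finset.mem_val, Finset.mem_filter] at hw
    simpa using hw.1
  simp only [Function.comp]
  split_ifs with h
  · rw [← h, Finset.union_self, hcard w hw, hsum w hw]
  · have hd := hdisj w hw _ (hρ w hw) h
    rw [Finset.card_union_of_disjoint hd, Finset.sum_union hd, hcard w hw, hsum w hw,
      hcard _ (hρ w hw), hsum _ (hρ w hw)]
    push_cast
    rfl

end ReturnMap

lemma IsPopDown.unique {L : Type*} [PartialOrder L] {x p q : L} (hp : IsPopDown x p)
    (hq : IsPopDown x q) : p = q :=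
  IsGLB.unique hp hq

lemma IsRow.unique {L : Type*} [PartialOrder L] {x y z : L} (hy : IsRow x y)
    (hz : IsRow x z) : y = z := by
  obtain ⟨p, hp, hy⟩ := hy
  obtain ⟨q, hq, hz⟩ := hz
  obtain rfl := hp.unique hq
  exact (hz y).1 ((hy y).2 rfl)

lemma IsRowmotion.unique {L : Type*} [PartialOrder L] {σ τ : Equiv.Perm L} (hσ : IsRowmotion σ)
    (hτ : IsRowmotion τ) : σ = τ :=
  Equiv.ext fun x => (hσ x).unique (hτ x)

end AltTamari

/-! ### The return to column `k`. -/

namespace AltTamari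

namespace Coordinates

variable {L : Type*} [PartialOrder L] {a b k : ℕ} (c : Coordinates L a b k)

/-- Here `q` counts the jumps to row a, including the first step. The alternatives for the column
are: back at k, climbing from 0 to k, or still right of k. Each jump leaves row 0 or column k and
costs one down-degree; the end of the row costs one more, and it has been passed exactly when the
column is at most k. -/
lemma pow_apply_section [Finite L] (hk : k ≤ b) (σ : Equiv.Perm L)
    (hσ : ∀ x, RowStep a b k (c.row x) (c.col x) (c.row (σ x)) (c.col (σ x)))
    (x : L) (hx : c.col x = k) (t : ℕ) (ht : t ≤ b + c.row x) :
    ∃ q, c.row ((σ ^ (t + 1)) x) + (t + 1) = (a + 1) * q ∧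
      (t = b + c.row x ∧ c.col ((σ ^ (t + 1)) x) = k ∨
        c.col ((σ ^ (t + 1)) x) < k ∧ t + k = b + c.row x + c.col ((σ ^ (t + 1)) x) ∨
        k < c.col ((σ ^ (t + 1)) x) ∧
          t + 1 + c.row ((σ ^ (t + 1)) x) + k = c.row x + c.col ((σ ^ (t + 1)) x)) ∧
      ∑ i ∈ Finset.range (t + 1), (ddeg ((σ ^ i) x) : ℤ) =
        2 * (t + 1) - q - (if c.col ((σ ^ (t + 1)) x) ≤ k then 1 else 0) := by
  induction t with
  | zero =>
    have h := hσ x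
    have h1 := c.row_le x
    refine ⟨1, ?_⟩
    simp only [zero_add, pow_one, Finset.range_one, Finset.sum_singleton, pow_zero,
      Equiv.Perm.one_apply, c.ddeg_eq hk, mul_one, Nat.cast_zero, Nat.cast_one]
    unfold RowStep at h
    refine ⟨by omega, by omega, ?_⟩
    split_ifs <;> omega
  | succ t ih =>
    obtain ⟨q, h1, h2, h3⟩ := ih (by omega)
    rw [Finset.sum_range_succ, h3, c.ddeg_eq hk, pow_succ' σ (t + 1), Equiv.Perm.mul_apply]
    have h := hσ ((σ ^ (t + 1)) x)
    have hcol := c.col_le (σ ((σ ^ (t + 1)) x))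
    have hcol' := c.col_le ((σ ^ (t + 1)) x)
    generalize σ ((σ ^ (t + 1)) x) = z at *
    generalize (σ ^ (t + 1)) x = y at *
    rcases Nat.eq_zero_or_pos (c.row y) with h0 | h0
    · refine ⟨q + 1, ?_⟩
      rw [mul_add, ← h1]
      -- The return time has not been reached yet, so the point is off column k and its row moves
      -- cyclically.
      have hn : ¬ c.col y = k := by omega
      rw [if_pos (Or.inl h0 : c.row y = 0 ∨ c.col y = k)]
      unfold RowStep at h
      push_cast
      refine ⟨by omega, by omega, ?_⟩
      split_ifs <;> omega
    · refine ⟨q, ?_⟩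
      rw [← h1]
      have hn : ¬ (c.row y = 0 ∨ c.col y = k) := by omega
      rw [if_neg hn]
      unfold RowStep at h
      push_cast
      refine ⟨by omega, by omega, ?_⟩
      split_ifs <;> omega

/-- `N` bounds the time to column k: k - j steps from the left; from the right b + u - j steps to
the end of the row, one to column 0 and k more. -/
lemma exists_section_sameCycle (σ : Equiv.Perm L)
    (hσ : ∀ x, RowStep a b k (c.row x) (c.col x) (c.row (σ x)) (c.col (σ x))) (N : ℕ) (x : L)
    (h1 : c.col x < k → k ≤ N + c.col x)
    (h2 : k < c.col x → b + c.row x + 1 + k ≤ N + c.col x) :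
    ∃ y, c.col y = k ∧ σ.SameCycle y x := by
  induction N generalizing x with
  | zero =>
    have := c.col_le x
    exact ⟨x, by omega, Equiv.Perm.SameCycle.refl _ _⟩
  | succ N ih =>
    by_cases hx : c.col x = k
    · exact ⟨x, hx, Equiv.Perm.SameCycle.refl _ _⟩
    · have h := hσ x
      unfold RowStep at h
      obtain ⟨y, hy, hyx⟩ := ih (σ x) (by omega) (by omega)
      exact ⟨y, hy, Equiv.Perm.sameCycle_apply_right.1 hyx⟩

/-- The row in which rowmotion returns to column `k` from row `w` of column `k`. -/
def returnRow (a r w : ℕ) : ℕ := if w + r ≤ a then a - r - w else 2 * a + 1 - r - w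

lemma orbitData_eq [Fintype L] (hk : k ≤ b) {s r : ℕ} (hb : b = s * (a + 1) + r) (hr : r ≤ a)
    (σ : Equiv.Perm L)
    (hσ : ∀ x, RowStep a b k (c.row x) (c.col x) (c.row (σ x)) (c.col (σ x))) :
    orbitData σ = ((Finset.range (a + 1)).filter fun w => w ≤ returnRow a r w).val.map fun w =>
      let n : ℕ → ℚ := fun w => b + w + 1
      let d : ℕ → ℚ := fun w => 2 * n w - s - if w + r ≤ a then 2 else 3
      if w = returnRow a r w then (n w, d w)
      else (n w + n (returnRow a r w), d w + d (returnRow a r w)) := by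
  -- The minimum only makes the section total on the naturals.
  have hS : ∀ w, ∃ x, c.row x = min w a ∧ c.col x = k := fun w =>
    c.surj _ _ (min_le_right _ _) (by omega)
  choose S hS1 hS2 using hS
  replace hS1 : ∀ w < a + 1, c.row (S w) = w := fun w hw => by rw [hS1]; omega
  have hρ : ∀ w < a + 1, returnRow a r w < a + 1 := by
    intro w hw
    unfold returnRow
    split_ifs <;> omega
  have hfin : ∀ w < a + 1, (σ ^ (b + w + 1)) (S w) = S (returnRow a r w) ∧
      ∑ i ∈ Finset.range (b + w + 1), (ddeg ((σ ^ i) (S w)) : ℤ) =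
        2 * (b + w + 1) - s - (if w + r ≤ a then 2 else 3) := by
    intro w hw
    obtain ⟨q, h1, h2, h3⟩ := c.pow_apply_section hk σ hσ (S w) (hS2 w) (b + w)
      (by rw [hS1 w hw])
    rw [hS1 w hw] at h2
    have h4 : c.col ((σ ^ (b + w + 1)) (S w)) = k := by
      have := c.col_le ((σ ^ (b + w + 1)) (S w))
      omega
    rw [if_pos h4.le] at h3
    have h5 := c.row_le ((σ ^ (b + w + 1)) (S w))
    rw [h3]
    -- Subtracting s(a + 1) leaves row + r + w + 1 = (a + 1)(q - s). The left side lies strictly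
    -- between 0 and 3(a + 1), so q - s is 1 or 2.
    have hq : q = s + if w + r ≤ a then 1 else 2 := by
      have hlo : s < q := by
        by_contra! hle
        have := Nat.mul_le_mul_left (a + 1) hle
        rw [mul_comm (a + 1) s] at this
        omega
      obtain ⟨p, rfl⟩ := Nat.exists_eq_add_of_lt hlo
      have h6 : c.row ((σ ^ (b + w + 1)) (S w)) + r + w + 1 = (a + 1) * (p + 1) := by
        have : (a + 1) * (s + p + 1) = s * (a + 1) + (a + 1) * (p + 1) := by ring
        omega
      have hp : p < 2 := by
        by_contra! hle
        have := Nat.mul_le_mul_left (a + 1) (Nat.add_le_add_right hle 1)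
        omega
      split_ifs <;> interval_cases p <;> omega
    refine ⟨c.inj _ _ ?_ (by rw [h4, hS2]), ?_⟩
    · rw [hS1 _ (hρ w hw)]
      unfold returnRow
      have : (a + 1) * q = s * (a + 1) + (a + 1) * (q - s) := by
        rw [mul_comm s, ← mul_add]
        congr 1
        split_ifs at hq <;> omega
      split_ifs at hq ⊢
      · have : q - s = 1 := by omega
        simp only [this] at *
        omega
      · have : q - s = 2 := by omega
        simp only [this] at *
        omega
    · rw [hq]
      split_ifs <;> push_cast <;> ring
  have hmain := orbitData_eq_map σ (a + 1) S (fun w => b + w + 1) (returnRow a r)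
    (fun w _ => by omega) hρ (fun w hw => by unfold returnRow; split_ifs <;> omega)
    (fun w hw => (hfin w hw).1) ?_ ?_
  · rw [hmain]
    refine Multiset.map_congr rfl fun w hw => ?_
    have hw : w < a + 1 := by
      rw [Finset.mem_val, Finset.mem_filter] at hw
      simpa using hw.1
    have key : ∀ w < a + 1, ∑ i ∈ Finset.range (b + w + 1), (ddeg ((σ ^ i) (S w)) : ℚ) =
        2 * (b + w + 1) - s - (if w + r ≤ a then 2 else 3) := by
      intro w hw
      exact_mod_cast congrArg (Int.cast : ℤ → ℚ) (hfin w hw).2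
    rw [key w hw, key _ (hρ w hw)]
    push_cast
    rfl
  · intro w hw w' hw' i hi h
    rcases i with _ | i
    · refine ⟨rfl, ?_⟩
      rw [pow_zero, Equiv.Perm.one_apply] at h
      rw [← hS1 w hw, ← hS1 w' hw', h]
    · obtain ⟨q, -, h2, -⟩ := c.pow_apply_section hk σ hσ (S w) (hS2 w) i
        (by rw [hS1 w hw]; omega)
      rw [h, hS2, hS1 w hw] at h2
      omega
  · intro x
    obtain ⟨y, hy, hyx⟩ := c.exists_section_sameCycle σ hσ (b + c.row x + 1 + k) x
      (by omega) (by omega)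
    have hlt : c.row y < a + 1 := Nat.lt_succ_of_le (c.row_le y)
    refine ⟨c.row y, hlt, ?_⟩
    rwa [c.inj (S (c.row y)) y (hS1 _ hlt) ((hS2 _).trans hy.symm)]

end Coordinates

/-! ### Counting the cycles of the return involution; homometry. -/

lemma map_val_filter_add_not {α β : Type*} (s : Finset α) (p : α → Prop) [DecidablePred p]
    (f : α → β) : s.val.map f = (s.filter p).val.map f + (s.filter fun x => ¬ p x).val.map f := by
  rw [← Multiset.map_add, Finset.filter_val, Finset.filter_val, Multiset.filter_add_not]

lemma map_val_eq_replicate {α β : Type*} (s : Finset α) (f : α → β) (v : β)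
    (h : ∀ x ∈ s, f x = v) : s.val.map f = Multiset.replicate s.card v := by
  rw [Multiset.map_congr rfl h, Multiset.map_const']
  rfl

lemma toNat_ceil_natCast_div_two (d : ℕ) : ⌈(d : ℚ) / 2⌉.toNat = (d + 1) / 2 := by
  have : ⌈(d : ℚ) / 2⌉ = ((d + 1) / 2 : ℕ) := by
    rw [Int.ceil_eq_iff]
    have h : d = 2 * ((d + 1) / 2) ∨ d + 1 = 2 * ((d + 1) / 2) := by omega
    generalize (d + 1) / 2 = e at h
    push_cast
    rcases h with h | h
    · subst h
      push_cast
      constructor <;> linarith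
    · have h : (d : ℚ) + 1 = 2 * e := by exact_mod_cast h
      constructor <;> linarith
  rw [this, Int.toNat_natCast]

lemma toNat_ceil_natCast_sub_one_div_two (d : ℕ) : ⌈((d : ℚ) - 1) / 2⌉.toNat = d / 2 := by
  have : ⌈((d : ℚ) - 1) / 2⌉ = (d / 2 : ℕ) := by
    rw [Int.ceil_eq_iff]
    have h : d = 2 * (d / 2) ∨ d = 2 * (d / 2) + 1 := by omega
    generalize d / 2 = e at h
    push_cast
    rcases h with h | h <;> subst h <;> push_cast <;> constructor <;> linarith
  rw [this, Int.toNat_natCast]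

/-- The involution preserves the two ranges w + r ≤ a and w + r > a, acting on each as a reflection.
Its 2-cycles give the orbits of types 1 and 2, its possible midpoints those of types 3 and 4. -/
lemma map_returnRow_eq_expectedOrbitData (a b s r : ℕ) (hr : r ≤ a) :
    (((Finset.range (a + 1)).filter fun w => w ≤ Coordinates.returnRow a r w).val.map fun w =>
      let n : ℕ → ℚ := fun w => b + w + 1
      let d : ℕ → ℚ := fun w => 2 * n w - s - if w + r ≤ a then 2 else 3
      if w = Coordinates.returnRow a r w then (n w, d w)
      else (n w + n (Coordinates.returnRow a r w), d w + d (Coordinates.returnRow a r w))) =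
    expectedOrbitData a b s r := by
  have hdef : ∀ w, Coordinates.returnRow a r w =
    if w + r ≤ a then a - r - w else 2 * a + 1 - r - w := fun _ => rfl
  rw [map_val_filter_add_not _ (fun w => w + r ≤ a),
    map_val_filter_add_not (Finset.filter _ _) (fun w => 2 * w + r < a),
    map_val_filter_add_not (Finset.filter (fun w => ¬ w + r ≤ a) _)
      (fun w => 2 * w + r < 2 * a + 1)]
  simp only [Finset.filter_filter]
  unfold expectedOrbitData
  extract_lets n₁ n₂ n₃ n₄ O₁ O₂ O₃ O₄
  rw [map_val_eq_replicate _ _ O₁, map_val_eq_replicate _ _ O₃, map_val_eq_replicate _ _ O₂,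
    map_val_eq_replicate _ _ O₄]
  · clear_value O₁ O₂ O₃ O₄
    have hc : (a : ℚ) - r = ((a - r : ℕ) : ℚ) := by push_cast [hr]; rfl
    rw [hc, toNat_ceil_natCast_div_two, toNat_ceil_natCast_sub_one_div_two]
    have e1 : ((Finset.range (a + 1)).filter fun w =>
        (w ≤ Coordinates.returnRow a r w ∧ w + r ≤ a) ∧ 2 * w + r < a) =
        Finset.range ((a - r + 1) / 2) := by
      ext w
      simp only [Finset.mem_filter, Finset.mem_range, hdef]
      split_ifs <;> omega
    have e2 : ((Finset.range (a + 1)).filter fun w =>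
        (w ≤ Coordinates.returnRow a r w ∧ ¬ w + r ≤ a) ∧ 2 * w + r < 2 * a + 1) =
        Finset.Ico (a - r + 1) (a - r + 1 + r / 2) := by
      ext w
      simp only [Finset.mem_filter, Finset.mem_range, hdef, Finset.mem_Ico]
      split_ifs <;> omega
    have e3 : ((Finset.range (a + 1)).filter fun w =>
        (w ≤ Coordinates.returnRow a r w ∧ w + r ≤ a) ∧ ¬ 2 * w + r < a) =
        Finset.Ico ((a - r + 1) / 2) ((a - r) / 2 + 1) := by
      ext w
      simp only [Finset.mem_filter, Finset.mem_range, hdef, Finset.mem_Ico]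
      split_ifs <;> omega
    have e4 : ((Finset.range (a + 1)).filter fun w =>
        (w ≤ Coordinates.returnRow a r w ∧ ¬ w + r ≤ a) ∧ ¬ 2 * w + r < 2 * a + 1) =
        Finset.Ico (a - r + 1 + r / 2) (a - r + 1 + (r + 1) / 2) := by
      ext w
      simp only [Finset.mem_filter, Finset.mem_range, hdef, Finset.mem_Ico]
      split_ifs <;> omega
    rw [e1, e2, e3, e4]
    simp only [Finset.card_range, Nat.card_Ico]
    -- The midpoints exist exactly when a and r have the same parity (first range) and when r is odd
    -- (second range).
    rw [show a - r + 1 + r / 2 - (a - r + 1) = r / 2 by omega,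
      show a - r + 1 + (r + 1) / 2 - (a - r + 1 + r / 2) = r % 2 by omega,
      show (a - r) / 2 + 1 - (a - r + 1) / 2 = (a + r + 1) % 2 by omega]
    rcases Nat.mod_two_eq_zero_or_one a with ha | ha <;>
      rcases Nat.mod_two_eq_zero_or_one r with hr' | hr'
    · rw [show (a + r + 1) % 2 = 1 by omega, hr']
      simp [Nat.even_iff, Nat.odd_iff, ha, hr']
      try abel
    · rw [show (a + r + 1) % 2 = 0 by omega, hr']
      simp [Nat.even_iff, Nat.odd_iff, ha, hr']
      try abel
    · rw [show (a + r + 1) % 2 = 0 by omega, hr']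
      simp [Nat.even_iff, Nat.odd_iff, ha, hr']
      try abel
    · rw [show (a + r + 1) % 2 = 1 by omega, hr']
      have : ({O₃, O₄} : Multiset (ℚ × ℚ)) = {O₃} + {O₄} := rfl
      simp [Nat.even_iff, Nat.odd_iff, ha, hr', this, -Multiset.singleton_add]
      abel
  all_goals
    intro w hw
    simp only [Finset.mem_filter, Finset.mem_range] at hw
    obtain ⟨hw0, ⟨hw1, hw2⟩, hw3⟩ := hw
    have hρ := hdef w
  · rw [if_neg hw2] at hρ
    rw [hρ] at hw1
    have h : ((2 * w + r : ℕ) : ℚ) = (2 * a + 1 : ℕ) := by congr 1; omega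
    push_cast at h
    rw [hρ, if_pos (by omega)]
    simp only [if_neg hw2, O₄, n₄, Prod.mk.injEq]
    constructor <;> linarith
  · rw [if_neg hw2] at hρ
    have h : ((w + Coordinates.returnRow a r w + r : ℕ) : ℚ) = (2 * a + 1 : ℕ) := by
      congr 1; omega
    push_cast at h
    rw [if_neg (by omega)]
    simp only [if_neg hw2, O₂, n₂, Prod.mk.injEq]
    rw [if_neg (by omega)]
    constructor <;> linarith
  · rw [if_pos hw2] at hρ
    rw [hρ] at hw1
    have h : ((2 * w + r : ℕ) : ℚ) = (a : ℕ) := by congr 1; omega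
    push_cast at h
    rw [hρ, if_pos (by omega)]
    simp only [if_pos hw2, O₃, n₃, Prod.mk.injEq]
    constructor <;> linarith
  · rw [if_pos hw2] at hρ
    have h : ((w + Coordinates.returnRow a r w + r : ℕ) : ℚ) = (a : ℕ) := by
      congr 1; omega
    push_cast at h
    rw [if_neg (by omega)]
    simp only [if_pos hw2, O₁, n₁, Prod.mk.injEq]
    rw [if_pos (by omega)]
    constructor <;> linarith

/-- For 0 ≤ r ≤ b and a ≥ 0 no two of the four size formulas agree, so the size determines the type
and with it the sum. -/
lemma isHomometric_of_orbitData {L : Type*} [PartialOrder L] [Fintype L] {a b s r : ℕ}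
    (hb : r ≤ b) (σ : Equiv.Perm L)
    (h : orbitData σ = expectedOrbitData a b s r) : IsHomometric σ ddeg := by
  have hb : (r : ℚ) ≤ b := by exact_mod_cast hb
  have ha : (0 : ℚ) ≤ a := by positivity
  have hmem : ∀ O ∈ orbits σ, ((O.card : ℚ), ∑ z ∈ O, (ddeg z : ℚ)) ∈
      expectedOrbitData a b s r := by
    intro O hO
    rw [← h, orbitData]
    exact Multiset.mem_map_of_mem _ hO
  have hr : (0 : ℚ) ≤ r := by positivity
  have key : ∀ p ∈ expectedOrbitData a b s r,
      (p.1 = a + 2 * b + 2 - r ∧ p.2 = 2 * p.1 - 4 - 2 * s) ∨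
      (p.1 = 2 * a + 2 * b + 3 - r ∧ p.2 = 2 * p.1 - 6 - 2 * s) ∨
      (p.1 = (a - r) / 2 + b + 1 ∧ p.2 = 2 * p.1 - 2 - s) ∨
      (p.1 = (3 - r) / 2 + a + b ∧ p.2 = 2 * p.1 - 3 - s) := by
    intro p hp
    unfold expectedOrbitData at hp
    extract_lets n₁ n₂ n₃ n₄ O₁ O₂ O₃ O₄ at hp
    have hp : p = O₁ ∨ p = O₂ ∨ p = O₃ ∨ p = O₄ := by
      simp only [Multiset.mem_add, Multiset.mem_replicate] at hp
      split_ifs at hp <;> simp at hp <;> tauto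
    rcases hp with rfl | rfl | rfl | rfl
    · exact Or.inl ⟨rfl, rfl⟩
    · exact Or.inr (Or.inl ⟨rfl, rfl⟩)
    · exact Or.inr (Or.inr (Or.inl ⟨rfl, rfl⟩))
    · exact Or.inr (Or.inr (Or.inr ⟨rfl, rfl⟩))
  intro O hO O' hO' hcard
  have hcard : (O.card : ℚ) = O'.card := by exact_mod_cast hcard
  have h1 := key _ (hmem O hO)
  have h2 := key _ (hmem O' hO')
  dsimp only at h1 h2
  have : ∑ z ∈ O, (ddeg z : ℚ) = ∑ z ∈ O', (ddeg z : ℚ) := by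
    rcases h1 with h1 | h1 | h1 | h1 <;> rcases h2 with h2 | h2 | h2 | h2 <;>
      linarith [h1.1, h1.2, h2.1, h2.2]
  exact_mod_cast this

end AltTamari

/-! ### Coordinates of the two-row lattice. -/

namespace AltTamari

open Step

/-- The path `E^i N E^j N E^l`. -/
def word (i j l : ℕ) : Path :=
  List.replicate i E ++ N :: (List.replicate j E ++ N :: List.replicate l E)

lemma twoRowPath_eq_word (a b : ℕ) : twoRowPath a b = word a b 0 := by
  simp [twoRowPath, word]

lemma count_N_word (i j l : ℕ) : (word i j l).count N = 2 := by
  simp [word, List.count_append, List.count_replicate]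

lemma count_E_word (i j l : ℕ) : (word i j l).count E = i + j + l := by
  simp [word, List.count_append]
  omega

lemma count_N_take_word (i j l m : ℕ) : ((word i j l).take m).count N =
    (if i < m then 1 else 0) + (if i + j + 1 < m then 1 else 0) := by
  unfold word
  rw [List.take_append, List.count_append, List.take_replicate, List.length_replicate]
  rcases Nat.lt_or_ge i m with h | h
  · obtain ⟨d, rfl⟩ := Nat.exists_eq_add_of_lt h
    rw [show i + d + 1 - i = d + 1 by omega, List.take_succ_cons, List.take_append,
      List.take_replicate, List.length_replicate, List.count_cons_self, List.count_append]
    rcases Nat.lt_or_ge j d with h' | h'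
    · obtain ⟨e, rfl⟩ := Nat.exists_eq_add_of_lt h'
      rw [show j + e + 1 - j = e + 1 by omega, List.take_succ_cons, List.take_replicate,
        List.count_cons_self, if_pos (by omega), if_pos (by omega)]
      simp [List.count_replicate]
    · rw [show d - j = 0 by omega, if_pos (by omega), if_neg (by omega)]
      simp [List.count_replicate]
  · rw [show m - i = 0 by omega, if_neg (by omega), if_neg (by omega)]
    simp [List.count_replicate]

/-- The positions of the two north steps can be read off from the north counts of prefixes. -/
lemma word_injective {i j l i' j' l' : ℕ} (h : word i j l = word i' j' l') :
    i = i' ∧ j = j' ∧ l = l' := by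
  have key : ∀ m, (if i < m then 1 else 0) + (if i + j + 1 < m then 1 else 0) =
      (if i' < m then 1 else 0) + (if i' + j' + 1 < m then 1 else 0) := by
    intro m
    rw [← count_N_take_word i j l, ← count_N_take_word i' j' l', h]
  have hE : i + j + l = i' + j' + l' := by rw [← count_E_word, ← count_E_word, h]
  have h1 := key (i + 1)
  have h2 := key (i' + 1)
  obtain rfl : i = i' := by split_ifs at h1 h2 <;> omega
  have h3 := key (i + j + 2)
  have h4 := key (i + j' + 2)
  split_ifs at h3 h4 <;> omega

lemma eq_replicate_of_count_N_eq_zero (w : Path) (h : w.count N = 0) :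
    w = List.replicate w.length E := by
  refine List.eq_replicate_iff.2 ⟨rfl, fun x hx => ?_⟩
  rcases x with _ | _
  · exact absurd hx (List.count_eq_zero.1 h)
  · rfl

lemma exists_replicate_append (w : Path) (h : 0 < w.count N) :
    ∃ i v, w = List.replicate i E ++ N :: v ∧ v.count N + 1 = w.count N := by
  induction w with
  | nil => simp at h
  | cons c w ih =>
    cases c
    · exact ⟨0, w, by simp, by simp⟩
    · obtain ⟨i, v, rfl, h'⟩ := ih (by simpa using h)
      exact ⟨i + 1, v, by simp [List.replicate_succ], by simpa using h'⟩

lemma exists_eq_word (w : Path) (h : w.count N = 2) : ∃ i j l, w = word i j l := by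
  obtain ⟨i, v, rfl, h1⟩ := exists_replicate_append w (by omega)
  obtain ⟨j, u, rfl, h2⟩ := exists_replicate_append v (by omega)
  exact ⟨i, j, u.length, by
    rw [word, ← eq_replicate_of_count_N_eq_zero u (by omega)]⟩

lemma isNuPath_word_iff (a b i j l : ℕ) : IsNuPath (twoRowPath a b) (word i j l) ↔
    i ≤ a ∧ i + j + l = a + b := by
  simp only [IsNuPath, twoRowPath_eq_word, count_N_word, count_E_word, count_N_take_word,
    true_and, add_zero]
  constructor
  · rintro ⟨h1, h2⟩
    have := h2 (a + 1)
    refine ⟨?_, h1⟩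
    split_ifs at this <;> omega
  · rintro ⟨h1, h2⟩
    refine ⟨h2, fun m => ?_⟩
    split_ifs <;> omega

lemma altitude_twoRowIncrement (k : ℕ) (w : Path) : altitude (twoRowIncrement k) w =
    (if w.count N = 0 then 0 else (k : ℤ)) - w.count E := by
  unfold altitude twoRowIncrement
  congr 1
  cases w.count N with
  | zero => simp
  | succ n =>
    rw [Finset.sum_range_succ']
    simp

/-- At the first valley the north step gains altitude k. If k ≤ j, the altitude is regained before
the second north step, otherwise only after it. At the second valley the gain is 0, so only that
north step is moved. -/
lemma word_of_rotation {k i j l : ℕ} {y : Path}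
    (hrot : Rotation (twoRowIncrement k) (word i j l) y) :
    (∃ i', i = i' + 1 ∧ (k ≤ j ∧ y = word i' (j + 1) l ∨ j < k ∧ y = word i' j (l + 1))) ∨
      ∃ j', j = j' + 1 ∧ y = word i j' (l + 1) := by
  have hE : ∀ n, List.replicate (n + 1) E = List.replicate n E ++ [E] := fun n =>
    List.replicate_succ'
  obtain ⟨p, q, t, h, rfl, hq, halt, hfirst⟩ := hrot
  cases q with
  | nil => simp at hq
  | cons c q =>
  obtain rfl : c = N := by simpa using hq
  simp only [altitude_twoRowIncrement, List.count_append] at halt hfirst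
  have hcount : p.count N + q.count N + t.count N = 1 := by
    have := congrArg (List.count N) h
    rw [count_N_word] at this
    simp [List.count_append] at this
    omega
  rcases Nat.eq_zero_or_pos (p.count N) with hp0 | hp0
  · rw [eq_replicate_of_count_N_eq_zero p hp0] at h halt hfirst ⊢
    generalize p.length = i' at *
    left
    by_cases hq0 : q.count N = 0
    · rw [eq_replicate_of_count_N_eq_zero q hq0] at h halt ⊢
      generalize q.length = m at *
      obtain ⟨j', v, rfl, hv⟩ := exists_replicate_append t (by omega)
      rw [eq_replicate_of_count_N_eq_zero v (by omega)] at h ⊢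
      have h' : word i j l = word (i' + 1) (m + j') v.length := by
        rw [h, word, hE, List.replicate_add]
        simp [-List.replicate_append_replicate]
      obtain ⟨rfl, rfl, rfl⟩ := word_injective h'
      simp [List.count_replicate] at halt
      refine ⟨i', rfl, Or.inl ⟨by omega, ?_⟩⟩
      rw [word, show m + j' + 1 = m + 1 + j' by omega, List.replicate_add, hE]
      simp [-List.replicate_append_replicate]
    · obtain ⟨m, v, rfl, hv⟩ := exists_replicate_append q (by omega)
      rw [eq_replicate_of_count_N_eq_zero t (by omega)] at h ⊢
      rw [eq_replicate_of_count_N_eq_zero v (by omega)] at h halt hfirst ⊢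
      generalize v.length = e at *
      generalize t.length = f at *
      have h' : word i j l = word (i' + 1) m (e + f) := by
        rw [h, word, hE, List.replicate_add]
        simp [-List.replicate_append_replicate]
      obtain ⟨rfl, rfl, rfl⟩ := word_injective h'
      -- This prefix N E^j ends just before the second north step; no return there excludes k = j.
      have h1 := hfirst (j + 1) (by omega) (by simp)
      rw [List.take_succ_cons, List.take_left' (by simp)] at h1
      simp [List.count_replicate] at halt h1
      refine ⟨i', rfl, Or.inr ⟨by omega, ?_⟩⟩
      rw [word, show e + f + 1 = e + 1 + f by omega, List.replicate_add, hE e]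
      simp [-List.replicate_append_replicate]
  · obtain ⟨i', v, rfl, hv⟩ := exists_replicate_append p hp0
    rw [eq_replicate_of_count_N_eq_zero t (by omega)] at h ⊢
    rw [eq_replicate_of_count_N_eq_zero v (by omega)] at h halt ⊢
    rw [eq_replicate_of_count_N_eq_zero q (by omega)] at h halt ⊢
    generalize v.length = j' at *
    generalize q.length = e at *
    generalize t.length = f at *
    have h' : word i j l = word i' (j' + 1) (e + f) := by
      rw [h, word, hE, List.replicate_add]
      simp [-List.replicate_append_replicate]
    obtain ⟨rfl, rfl, rfl⟩ := word_injective h'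
    simp [List.count_replicate] at halt
    obtain rfl : e = 0 := by omega
    refine Or.inr ⟨j', rfl, ?_⟩
    rw [word, show 0 + f + 1 = 1 + f by omega, List.replicate_add]
    simp [-List.replicate_append_replicate]

lemma rotation_word_of_le {k i j l : ℕ} (h : k ≤ j) :
    Rotation (twoRowIncrement k) (word (i + 1) j l) (word i (j + 1) l) := by
  obtain ⟨d, rfl⟩ := Nat.exists_eq_add_of_le h
  refine ⟨List.replicate i E, N :: List.replicate k E,
    List.replicate d E ++ N :: List.replicate l E, ?_, ?_, rfl, ?_, ?_⟩
  · rw [word, List.replicate_succ', List.replicate_add]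
    simp [-List.replicate_append_replicate]
  · rw [word, show k + d + 1 = k + 1 + d by omega, List.replicate_add, List.replicate_succ']
    simp [-List.replicate_append_replicate]
  · simp [altitude_twoRowIncrement, List.count_append, List.count_replicate]
    ring
  · intro m hm hm'
    obtain ⟨m, rfl⟩ := Nat.exists_eq_succ_of_ne_zero hm.ne'
    simp only [List.length_cons, List.length_replicate] at hm'
    simp [altitude_twoRowIncrement, List.count_append, List.count_replicate]
    omega

/-- The hypothesis `k ≤ j + l` leaves enough east steps after the second north step to use up the k
- j still missing. -/
lemma rotation_word_of_lt {k i j l : ℕ} (h : j < k) (hl : k ≤ j + l) :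
    Rotation (twoRowIncrement k) (word (i + 1) j l) (word i j (l + 1)) := by
  obtain ⟨d, rfl⟩ := Nat.exists_eq_add_of_le h.le
  obtain ⟨e, rfl⟩ : ∃ e, l = d + e := Nat.exists_eq_add_of_le (by omega)
  refine ⟨List.replicate i E, N :: (List.replicate j E ++ N :: List.replicate d E),
    List.replicate e E, ?_, ?_, rfl, ?_, ?_⟩
  · rw [word, List.replicate_succ', List.replicate_add]
    simp [-List.replicate_append_replicate]
  · rw [word, show d + e + 1 = d + 1 + e by omega, List.replicate_add, List.replicate_succ']
    simp [-List.replicate_append_replicate]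
  · simp [altitude_twoRowIncrement, List.count_append, List.count_replicate]
    ring
  · intro m hm hm'
    obtain ⟨m, rfl⟩ := Nat.exists_eq_succ_of_ne_zero hm.ne'
    simp only [List.length_cons, List.length_append, List.length_replicate] at hm'
    rw [List.take_succ_cons, List.take_append, List.take_replicate, List.length_replicate]
    rcases Nat.lt_or_ge j m with h1 | h1
    · obtain ⟨f, rfl⟩ := Nat.exists_eq_add_of_lt h1
      rw [show j + f + 1 - j = f + 1 by omega, List.take_succ_cons, List.take_replicate]
      simp [altitude_twoRowIncrement, List.count_append, List.count_replicate]
      omega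
    · rw [show m - j = 0 by omega]
      simp [altitude_twoRowIncrement, List.count_append, List.count_replicate]
      omega

lemma rotation_word_second (k i j l : ℕ) :
    Rotation (twoRowIncrement k) (word i (j + 1) l) (word i j (l + 1)) := by
  refine ⟨List.replicate i E ++ N :: List.replicate j E, [N], List.replicate l E,
    ?_, ?_, rfl, ?_, ?_⟩
  · rw [word, List.replicate_succ']
    simp
  · rw [word, List.replicate_succ]
    simp
  · simp [altitude_twoRowIncrement, List.count_append, List.count_replicate]
  · intro m hm hm'
    simp at hm'
    omega

lemma TwoRow.exists_coordinates {a b k : ℕ} (x : TwoRow a b k) :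
    ∃ u j, u ≤ a ∧ j ≤ b + u ∧ x.path = word (a - u) j (b + u - j) := by
  obtain ⟨i, j, l, h⟩ := exists_eq_word x.path (by
    rw [x.isNuPath.1, twoRowPath_eq_word, count_N_word])
  have h1 := x.isNuPath
  rw [h, isNuPath_word_iff] at h1
  refine ⟨a - i, j, by omega, by omega, ?_⟩
  rw [h]
  congr 1 <;> omega

lemma TwoRow.isNuPath_word {a b u j : ℕ} (hu : u ≤ a) (hj : j ≤ b + u) :
    IsNuPath (twoRowPath a b) (word (a - u) j (b + u - j)) :=
  (isNuPath_word_iff _ _ _ _ _).2 (by omega)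

/-- The path with coordinates `(u, j)`. -/
def TwoRow.mk {a b : ℕ} (k : ℕ) {u j : ℕ} (hu : u ≤ a) (hj : j ≤ b + u) : TwoRow a b k :=
  ⟨word (a - u) j (b + u - j), TwoRow.isNuPath_word hu hj⟩

lemma TwoRow.mk_le_of_rotation {a b k u j u' j' : ℕ} (hu : u ≤ a) (hj : j ≤ b + u)
    (hu' : u' ≤ a) (hj' : j' ≤ b + u')
    (h : Rotation (twoRowIncrement k) (word (a - u) j (b + u - j))
      (word (a - u') j' (b + u' - j'))) :
    TwoRow.mk k hu hj ≤ TwoRow.mk k hu' hj' :=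
  Relation.ReflTransGen.single h

lemma TwoRow.mk_le_mk_col {a b k u j d : ℕ} (hu : u ≤ a) (hj : j + d ≤ b + u) :
    TwoRow.mk k hu hj ≤ TwoRow.mk k hu (show j ≤ b + u by omega) := by
  induction d with
  | zero => exact le_rfl
  | succ d ih =>
    refine le_trans (TwoRow.mk_le_of_rotation _ _ hu (show j + d ≤ b + u by omega) ?_) (ih _)
    rw [show b + u - (j + d) = b + u - (j + (d + 1)) + 1 by omega]
    exact rotation_word_second _ _ _ _

lemma TwoRow.mk_le_mk_row_of_lt {a b k u j d : ℕ} (hk : k ≤ b) (hu : u + d ≤ a) (hj : j < k) :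
    TwoRow.mk k (show u ≤ a by omega) (show j ≤ b + u by omega) ≤
      TwoRow.mk k hu (show j ≤ b + (u + d) by omega) := by
  induction d with
  | zero => exact le_rfl
  | succ d ih =>
    refine le_trans (ih (by omega)) (TwoRow.mk_le_of_rotation _ _ _ _ ?_)
    rw [show a - (u + d) = a - (u + (d + 1)) + 1 by omega,
      show b + (u + (d + 1)) - j = b + (u + d) - j + 1 by omega]
    exact rotation_word_of_lt hj (by omega)

lemma TwoRow.mk_le_mk_row_of_le {a b k u j d : ℕ} (hu : u + d ≤ a) (hk : k ≤ j)
    (hj : j ≤ b + u) :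
    TwoRow.mk k (show u ≤ a by omega) hj ≤
      TwoRow.mk k hu (show j + d ≤ b + (u + d) by omega) := by
  induction d with
  | zero => exact le_rfl
  | succ d ih =>
    refine le_trans (ih (by omega)) (TwoRow.mk_le_of_rotation _ _ _ _ ?_)
    rw [show a - (u + d) = a - (u + (d + 1)) + 1 by omega,
      show b + (u + (d + 1)) - (j + (d + 1)) = b + (u + d) - (j + d) by omega]
    exact rotation_word_of_le (by omega)

/-- The row is raised first, by rotations at the first valley: the column stays fixed if j < k and
otherwise grows with the row. Rotations at the second valley then lower the column to j'. -/
lemma TwoRow.mk_le_mk {a b k u j u' j' : ℕ} (hk : k ≤ b) (hu : u ≤ a) (hj : j ≤ b + u)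
    (hu' : u' ≤ a) (hj' : j' ≤ b + u') (h1 : u ≤ u') (h2 : min j' k ≤ j)
    (h3 : j' + u ≤ j + u') : TwoRow.mk k hu hj ≤ TwoRow.mk k hu' hj' := by
  obtain ⟨d, rfl⟩ := Nat.exists_eq_add_of_le h1
  rcases Nat.lt_or_ge j k with h | h
  · obtain ⟨e, rfl⟩ : ∃ e, j = j' + e := Nat.exists_eq_add_of_le (by omega)
    exact (TwoRow.mk_le_mk_row_of_lt hk hu' h).trans (TwoRow.mk_le_mk_col hu' (by omega))
  · refine (TwoRow.mk_le_mk_row_of_le hu' h hj).trans ?_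
    obtain ⟨e, he⟩ : ∃ e, j + d = j' + e := Nat.exists_eq_add_of_le (by omega)
    simp only [he]
    exact TwoRow.mk_le_mk_col hu' (by omega)

/-- The coordinates of the alt 2-row-Tamari lattice. -/
lemma TwoRow.nonempty_coordinates {a b k : ℕ} (hk : k ≤ b) :
    Nonempty (Coordinates (TwoRow a b k) a b k) := by
  choose u j hu hj hpath using fun x : TwoRow a b k => x.exists_coordinates
  have hmk : ∀ x, x = TwoRow.mk k (hu x) (hj x) := fun x => Tam.ext (hpath x)
  refine ⟨⟨u, j, hu, hj, ?_, ?_, ?_⟩⟩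
  · intro x y h1 h2
    refine Tam.ext ?_
    rw [hpath, hpath, h1, h2]
  · intro v i hv hi
    refine ⟨TwoRow.mk k hv hi, ?_⟩
    have h := word_injective (hpath (TwoRow.mk k hv hi)).symm
    have := hu (TwoRow.mk k hv hi)
    omega
  · intro x y
    constructor
    · intro h
      -- Each of the three kinds of rotation preserves the three inequalities.
      induction h with
      | refl => omega
      | @tail y z _ hyz ih =>
        rw [hpath y] at hyz
        have hy := hu y
        have hz := hu z
        have hy' := hj y
        rcases word_of_rotation hyz with ⟨i', h1, ⟨h2, h3⟩ | ⟨h2, h3⟩⟩ | ⟨j', h1, h3⟩ <;>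
        · rw [hpath z] at h3
          have h4 := word_injective h3
          omega
    · rintro ⟨h1, h2, h3⟩
      rw [hmk x, hmk y]
      exact TwoRow.mk_le_mk hk _ _ _ _ h1 h2 h3

end AltTamari

theorem theorem4p9 (a b s r : ℕ) (hb : b = s * (a + 1) + r) (hr : r ≤ a) :
    (∀ k ≤ b, ∃ σ : Equiv.Perm (AltTamari.TwoRow a b k),
      AltTamari.IsRowmotion σ ∧
      AltTamari.orbitData σ = AltTamari.expectedOrbitData a b s r ∧
      AltTamari.IsHomometric σ AltTamari.ddeg) ∧
    (∀ k ≤ b, ∀ k' ≤ b,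
      ∀ (σ : Equiv.Perm (AltTamari.TwoRow a b k)) (σ' : Equiv.Perm (AltTamari.TwoRow a b k')),
      AltTamari.IsRowmotion σ → AltTamari.IsRowmotion σ' →
      AltTamari.orbitData σ = AltTamari.orbitData σ') := by
  have key : ∀ k ≤ b, ∃ σ : Equiv.Perm (AltTamari.TwoRow a b k),
      AltTamari.IsRowmotion σ ∧
      AltTamari.orbitData σ = AltTamari.expectedOrbitData a b s r ∧
      AltTamari.IsHomometric σ AltTamari.ddeg := by
    intro k hk
    obtain ⟨c⟩ := AltTamari.TwoRow.nonempty_coordinates (a := a) hk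
    obtain ⟨σ, hσ, hstep⟩ := c.exists_rowmotion hk
    have hdata : AltTamari.orbitData σ = AltTamari.expectedOrbitData a b s r :=
      (c.orbitData_eq hk hb hr σ hstep).trans
        (AltTamari.map_returnRow_eq_expectedOrbitData a b s r hr)
    exact ⟨σ, hσ, hdata, AltTamari.isHomometric_of_orbitData (by omega) σ hdata⟩
  refine ⟨key, fun k hk k' hk' σ σ' hσ hσ' => ?_⟩
  obtain ⟨τ, hτ, hdata, -⟩ := key k hk
  obtain ⟨τ', hτ', hdata', -⟩ := key k' hk'
  rw [hσ.unique hτ, hσ'.unique hτ', hdata, hdata']
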